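/- \textbf{Setting.} Let $S_1\subseteq\{1,\dots,d\}$, $L>0$, $\alpha\in(0,1]$, $D_1>0$, and let $$f(\mathbf x)=\mu+\sum_{p\in S_1}\phi_p(x_p)\qquad(\mathbf x\in[-1,1]^d),$$ where for every $p\in S_1$: $\phi_p(0)=0$; $|\phi_p(x)-\phi_p(y)|\le L|x-y|^\alpha$ for all $x,y\in[-1,1]$; and $|\phi_p(x_p^*)|>D_1$ for some $x_p^*\in[-1,1]$. A query at $\mathbf x\in[-1,1]^d$ returns $f(\mathbf x)+\eta$, where the noise $\eta$ is arbitrary with $|\eta|\le\varepsilon$. \textbf{Algorithm 1} (parameters $m,n\in\mathbb N$, threshold $\tau$). Draw an $n\times d$ matrix $\mathbf B$ with independent entries that are $+1$ or $-1$ with probability $1/2$ each. Start with $\widehat S=\emptyset$. For each of the $2m+1$ points $\mathbf x=(c,\dots,c)$, $c\in\{-1,-\frac{m-1}{m},\dots,\frac{m-1}{m},1\}$, and each row $\beta_i$ of $\mathbf B$, query the points $\mathbf x_i^{+}$ and $\mathbf x_i^{-}$ obtained from $\mathbf x$ by setting to $0$ the coordinates where $\beta_i$ is $-1$, respectively $+1$.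 Let $y_i$ be the difference of the two answers, let $\widehat{\mathbf z}(\mathbf x)$ be a solution of $$\text{(P1)}\qquad \min_{\mathbf z\in\mathbb R^d}\|\mathbf z\|_1\quad\text{subject to}\quad\|\mathbf y-\mathbf B\mathbf z\|_2\le\nu ,$$ and add to $\widehat S$ all $p$ with $|\widehat z_p(\mathbf x)|>\tau$. Output $\widehat S$. \textbf{Theorem.} There are absolute constants $C_2,\tilde c_2>0$, and for each $\theta\in(0,1)$ a constant $\tilde c_1=\tilde c_1(\theta)>0$, such that the following holds for every $d$, every $f$ as above with $|S_1|\le\theta d$, and every $\varepsilon\ge0$. If $$\varepsilon<\frac{D_1}{6C_2},\qquad m\ge\Bigl(\frac{3L}{D_1}\Bigr)^{1/\alpha},\qquad n\ge\tilde c_1\,|S_1|\log\frac{d}{|S_1|},$$ (where $|S_1|\log(d/|S_1|):=0$ if $S_1=\emptyset$), and Algorithm 1 is run with $\nu=2\varepsilon\sqrt n$ and $\tau=2C_2\varepsilon$, then with probability at least $1-2\exp(-\tilde c_2n)$ over $\mathbf B$ one has $\widehat S=S_1$, for all admissible noise values and all choices of solutions of (P1). The number of queries is exactly $2(2m+1)n$,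 and it satisfies $$2(2m+1)n\ \ge\ \tilde c_1\,\bar c_1\,|S_1|\log\frac{d}{|S_1|},\qquad \bar c_1=2\Bigl(2\bigl(\tfrac{3L}{D_1}\bigr)^{1/\alpha}+1\Bigr)>1,$$ so it is $\Omega\bigl(\bar c_1|S_1|\log(d/|S_1|)\bigr)$ with $\bar c_1$ depending only on $L,D_1,\alpha$. -/

import Mathlib

open MeasureTheory ProbabilityTheory
open scoped Matrix

/-- A random `n × d` matrix with values in `{-1, +1}`, all of whose entries are independent
Rademacher variables. -/
structure IsRademacherMatrix {Ω : Type*} [MeasurableSpace Ω] (P : Measure Ω) {n d : ℕ}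
    (B : Ω → Matrix (Fin n) (Fin d) ℝ) : Prop where
  measurable : ∀ i j, Measurable fun ω => B ω i j
  mem_signs : ∀ ω i j, B ω i j = 1 ∨ B ω i j = -1
  prob_pos : ∀ i j, P.real {ω | B ω i j = 1} = 1 / 2
  prob_neg : ∀ i j, P.real {ω | B ω i j = -1} = 1 / 2
  indep : iIndepFun (fun (q : Fin n × Fin d) (ω : Ω) => B ω q.1 q.2) P

/-- The model: on the cube `[-1,1]^d` the function `f` equals `μ + ∑ p ∈ S, φ p (x p)`, where the
components vanish at `0`, are Hölder continuous on `[-1,1]` with exponent `α` and constant `L`, and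
each exceeds `D` in absolute value at some point of `[-1,1]`. -/
structure IsSparseAdditiveModel {d : ℕ} (f : (Fin d → ℝ) → ℝ) (S : Finset (Fin d)) (μ : ℝ)
    (φ : Fin d → ℝ → ℝ) (L α D : ℝ) : Prop where
  repr : ∀ x : Fin d → ℝ, (∀ i, x i ∈ Set.Icc (-1 : ℝ) 1) → f x = μ + ∑ p ∈ S, φ p (x p)
  map_zero : ∀ p ∈ S, φ p 0 = 0
  holder : ∀ p ∈ S, ∀ x ∈ Set.Icc (-1 : ℝ) 1, ∀ y ∈ Set.Icc (-1 : ℝ) 1,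
    |φ p x - φ p y| ≤ L * |x - y| ^ α
  identifiable : ∀ p ∈ S, ∃ x ∈ Set.Icc (-1 : ℝ) 1, D < |φ p x|

/-- `z` solves (P1): it minimises the `ℓ₁` norm subject to `‖y - B z‖₂ ≤ ν`. -/
def IsP1Solution {n d : ℕ} (ν : ℝ) (y : Fin n → ℝ) (B : Matrix (Fin n) (Fin d) ℝ)
    (z : Fin d → ℝ) : Prop :=
  ‖WithLp.toLp 2 (y - B *ᵥ z)‖ ≤ ν ∧
    ∀ w : Fin d → ℝ, ‖WithLp.toLp 2 (y - B *ᵥ w)‖ ≤ ν → ‖WithLp.toLp 1 z‖ ≤ ‖WithLp.toLp 1 w‖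

/-- A sparse recovery routine instantiated with (P1): given `y` and `B`, it returns some solution
of (P1) whenever (P1) has a solution. -/
def IsP1Solver {n d : ℕ} (ν : ℝ)
    (sparseRec : (Fin n → ℝ) → Matrix (Fin n) (Fin d) ℝ → Fin d → ℝ) : Prop :=
  ∀ y B, (∃ z, IsP1Solution ν y B z) → IsP1Solution ν y B (sparseRec y B)

noncomputable section

/-- The query point `x⁺`: keep the coordinates where the sign is `+1`, put `0` elsewhere. -/
def plusPoint {d : ℕ} (x β : Fin d → ℝ) : Fin d → ℝ := fun i => if β i = 1 then x i else 0

/-- The query point `x⁻`: keep the coordinates where the sign is `-1`, put `0` elsewhere. -/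
def minusPoint {d : ℕ} (x β : Fin d → ℝ) : Fin d → ℝ := fun i => if β i = -1 then x i else 0

/-- The `2m+1` points `(c, …, c)` with `c ∈ {-1, -(m-1)/m, …, (m-1)/m, 1}`. -/
def diagonalGrid (d m : ℕ) : List (Fin d → ℝ) :=
  (List.range (2 * m + 1)).map fun j => fun _ => ((j : ℝ) - (m : ℝ)) / (m : ℝ)

/-- Run `g 0, g 1, …, g (n-1)` in this order and return the vector of the results. -/
def collectVec {M : Type → Type} [Monad M] : (n : ℕ) → (Fin n → M ℝ) → M (Fin n → ℝ)
  | 0, _ => pure Fin.elim0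
  | n + 1, g => do
      let a ← g 0
      let v ← collectVec n fun i => g i.succ
      pure (Fin.cons a v)

/-- The support estimation algorithm. It has access to the unknown function only through
calls of `query`. For each grid point `x` it queries the points `x⁺`, `x⁻` belonging to each row
of `B`, collects the differences of the answers in `y`, and adds to the current set the
coordinates at which `sparseRec y B` exceeds the threshold `thr` in absolute value. -/
def supportAlgorithm {M : Type → Type} [Monad M] {n d : ℕ} (query : (Fin d → ℝ) → M ℝ)
    (sparseRec : (Fin n → ℝ) → Matrix (Fin n) (Fin d) ℝ → Fin d → ℝ) (m : ℕ) (thr : ℝ)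
    (B : Matrix (Fin n) (Fin d) ℝ) : M (Finset (Fin d)) :=
  (diagonalGrid d m).foldlM (fun (S : Finset (Fin d)) (x : Fin d → ℝ) => do
    let y ← collectVec n fun i => do
      let a ← query (plusPoint x (B i))
      let b ← query (minusPoint x (B i))
      pure (a - b)
    pure (S ∪ Finset.univ.filter fun p => thr < |sparseRec y B p|)) ∅

/-- The noisy query oracle. The state counts the queries made so far; the query number `t`
at the point `x` is answered by `f x + η t`. -/
def noisyQuery {d : ℕ} (f : (Fin d → ℝ) → ℝ) (η : ℕ → ℝ) (x : Fin d → ℝ) : StateM ℕ ℝ :=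
  modifyGet fun t => (f x + η t, t + 1)

/-- Run the algorithm on `f` with noise sequence `η`, starting with the query counter at `0`.
The result is the returned set together with the number of queries made. -/
def runAlgorithm {n d : ℕ} (f : (Fin d → ℝ) → ℝ) (η : ℕ → ℝ)
    (sparseRec : (Fin n → ℝ) → Matrix (Fin n) (Fin d) ℝ → Fin d → ℝ) (m : ℕ) (thr : ℝ)
    (B : Matrix (Fin n) (Fin d) ℝ) : Finset (Fin d) × ℕ :=
  (supportAlgorithm (noisyQuery f η) sparseRec m thr B).run 0

/-- The constant in the query bound; it depends on `L`, `D`, `α` only. -/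
def queryConst (L D α : ℝ) : ℝ := 2 * (2 * (3 * L / D) ^ (1 / α) + 1)

end

/-! Since every component vanishes at 0, the two query points of a row with signs `β` have noiseless
difference `∑ p ∈ S, β p * φ p c`. So each grid point `c` yields noisy linear measurements, by `B`,
of a vector `w` supported on `S`, with ℓ₂ error at most `2 * ε * √n`. If (P1) recovers `w` up to `8
* ε` in every coordinate, then coordinates off `S` never exceed the threshold; a coordinate in `S`
does so at a grid point close to where `φ p` exceeds `D`.

Recovery needs only a one-sided estimate `‖B x‖² ≥ (n/4) ‖x‖²` on the cone `‖x‖₁² ≤ 4 k ‖x‖²`, `k =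
|S|`, which contains the error of any ℓ₁ minimiser. It is proved without the restricted isometry
property. For a fixed vector, second and fourth moments of a Rademacher sum bound the Laplace
transform of `‖B z‖²` at a negative argument, so the lower tail is at most `exp (-n/24)`. A union
bound covers all sums of `8 k + 1` vectors `± e_j`, which costs `exp (n/48)`. Maurey's empirical
method then passes from these finitely many sums to the whole cone. The main lemmas are `maurey`,
`cone_lower_bound`, `IsRademacherMatrix.lower_tail` and `abs_sub_le_of_isP1Solution`. -/

/-! ### Execution of the algorithm and its query count -/

theorem collectVec_run (n c : ℕ) (g : Fin n → StateM ℕ ℝ) (r : Fin n → ℕ → ℝ)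
    (h : ∀ i t, (g i).run t = (r i t, t + c)) (t : ℕ) :
    (collectVec n g).run t = (fun i : Fin n => r i (t + c * i), t + c * n) := by
  induction n generalizing t with
  | zero =>
    simp only [collectVec, StateT.run_pure, mul_zero, add_zero]
    exact congrArg (fun v => (v, t)) (Subsingleton.elim _ _)
  | succ n ih =>
    have h1 := ih (fun i => g i.succ) (fun i => r i.succ) (fun i t => h i.succ t) (t + c)
    have e : (collectVec (n + 1) g).run t =
        (Fin.cons ((g 0).run t).1
          ((collectVec n fun i => g i.succ).run ((g 0).run t).2).1,
          ((collectVec n fun i => g i.succ).run ((g 0).run t).2).2) := rfl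
    rw [e, h, h1]
    refine Prod.ext ?_ ?_
    · funext i
      refine Fin.cases ?_ (fun i => ?_) i
      · simp
      · simp only [Fin.cons_succ, Fin.val_succ]
        congr 1
        ring
    · dsimp only
      ring

/-- The counter value at which each element is processed is left existential: the noise bound is
uniform in time, so nothing more is needed. -/
theorem foldlM_union_run {X : Type} {d : ℕ} (c : ℕ)
    (step : Finset (Fin d) → X → StateM ℕ (Finset (Fin d))) (F : X → ℕ → Finset (Fin d))
    (h : ∀ S x t, (step S x).run t = (S ∪ F x t, t + c)) (l : List X) (S : Finset (Fin d)) (t : ℕ) :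
    ((l.foldlM step S).run t).2 = t + c * l.length ∧
      S ⊆ ((l.foldlM step S).run t).1 ∧
      (∀ x ∈ l, ∃ t', F x t' ⊆ ((l.foldlM step S).run t).1) ∧
      ∀ p ∈ ((l.foldlM step S).run t).1, p ∈ S ∨ ∃ x ∈ l, ∃ t', p ∈ F x t' := by
  induction l generalizing S t with
  | nil =>
    have e : (([] : List X).foldlM step S).run t = (S, t) := rfl
    rw [e]
    simp
  | cons a l ih =>
    have e : ((a :: l).foldlM step S).run t = (l.foldlM step (S ∪ F a t)).run (t + c) := by
      rw [List.foldlM_cons, StateT.run_bind, h]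
      rfl
    obtain ⟨h1, h2, h3, h4⟩ := ih (S ∪ F a t) (t + c)
    rw [e]
    refine ⟨?_, ?_, ?_, ?_⟩
    · rw [h1, List.length_cons]; ring
    · exact Finset.subset_union_left.trans h2
    · intro x hx
      rcases List.mem_cons.1 hx with rfl | hx
      · exact ⟨t, Finset.subset_union_right.trans h2⟩
      · exact h3 x hx
    · intro p hp
      rcases h4 p hp with hp | ⟨x, hx, t', hp⟩
      · rcases Finset.mem_union.1 hp with hp | hp
        · exact Or.inl hp
        · exact Or.inr ⟨a, List.mem_cons_self, t, hp⟩
      · exact Or.inr ⟨x, List.mem_cons_of_mem _ hx, t', hp⟩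

theorem diagonalGrid_eq (d m : ℕ) : diagonalGrid d m =
    (List.range (2 * m + 1)).map fun (j : ℕ) (_ : Fin d) => ((j : ℝ) - (m : ℝ)) / (m : ℝ) := by
  simp only [diagonalGrid, List.bind_eq_flatMap, List.pure_def, List.map_flatMap, List.map_cons,
    List.map_nil]
  rw [List.map_eq_flatMap]

/-- The differences of the noisy answers for the point `x` when the query counter starts at `t`. -/
noncomputable def answerDiff {n d : ℕ} (f : (Fin d → ℝ) → ℝ) (η : ℕ → ℝ)
    (B : Matrix (Fin n) (Fin d) ℝ) (x : Fin d → ℝ) (t : ℕ) (i : Fin n) : ℝ :=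
  f (plusPoint x (B i)) + η (t + 2 * i) - (f (minusPoint x (B i)) + η (t + 2 * i + 1))

/-- The coordinates selected by one step of the algorithm. -/
noncomputable def selected {n d : ℕ} (f : (Fin d → ℝ) → ℝ) (η : ℕ → ℝ)
    (sparseRec : (Fin n → ℝ) → Matrix (Fin n) (Fin d) ℝ → Fin d → ℝ) (thr : ℝ)
    (B : Matrix (Fin n) (Fin d) ℝ) (x : Fin d → ℝ) (t : ℕ) : Finset (Fin d) :=
  Finset.univ.filter fun p => thr < |sparseRec (answerDiff f η B x t) B p|

theorem runAlgorithm_spec {n d : ℕ} (f : (Fin d → ℝ) → ℝ) (η : ℕ → ℝ)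
    (sparseRec : (Fin n → ℝ) → Matrix (Fin n) (Fin d) ℝ → Fin d → ℝ) (m : ℕ) (thr : ℝ)
    (B : Matrix (Fin n) (Fin d) ℝ) :
    (runAlgorithm f η sparseRec m thr B).2 = 2 * (2 * m + 1) * n ∧
      (∀ x ∈ diagonalGrid d m, ∃ t,
        selected f η sparseRec thr B x t ⊆ (runAlgorithm f η sparseRec m thr B).1) ∧
      ∀ p ∈ (runAlgorithm f η sparseRec m thr B).1, ∃ x ∈ diagonalGrid d m, ∃ t,
        p ∈ selected f η sparseRec thr B x t := by
  have hstep : ∀ (S : Finset (Fin d)) (x : Fin d → ℝ) (t : ℕ),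
      StateT.run (do
        let y ← collectVec n fun i => do
          let a ← noisyQuery f η (plusPoint x (B i))
          let b ← noisyQuery f η (minusPoint x (B i))
          pure (a - b)
        pure (S ∪ Finset.univ.filter fun p => thr < |sparseRec y B p|) : StateM ℕ (Finset (Fin d))) t =
      (S ∪ selected f η sparseRec thr B x t, t + 2 * n) := by
    intro S x t
    have hc := collectVec_run n 2 (fun i => do
          let a ← noisyQuery f η (plusPoint x (B i))
          let b ← noisyQuery f η (minusPoint x (B i))
          pure (a - b))
        (fun i t => f (plusPoint x (B i)) + η t - (f (minusPoint x (B i)) + η (t + 1)))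
        (fun i t => rfl) t
    rw [StateT.run_bind, hc]
    rfl
  obtain ⟨h1, -, h3, h4⟩ := foldlM_union_run (2 * n) _ (selected f η sparseRec thr B) hstep
    (diagonalGrid d m) ∅ 0
  refine ⟨h1.trans ?_, h3, fun p hp => ?_⟩
  · simp only [diagonalGrid_eq, List.length_map, List.length_range]
    ring
  · simpa using h4 p hp

/-! ### Maurey's empirical method and the lower bound on the cone -/

/-- Maurey's empirical method for a bilinear form: nonnegativity at all sums of `s` vectors `v i`
gives a lower bound at their weighted mean. -/
theorem maurey_aux {ι E : Type*} [Fintype ι] [AddCommGroup E] [Module ℝ E]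
    (Q : LinearMap.BilinForm ℝ E) (p : ι → ℝ) (hp : ∀ i, 0 ≤ p i) (hp1 : ∑ i, p i = 1)
    (v : ι → E) (x : E) (hx : ∑ i, p i • v i = x) (s : ℕ) (u : E)
    (h : ∀ t : Multiset ι, t.card = s → 0 ≤ Q (u + (t.map v).sum) (u + (t.map v).sum)) :
    0 ≤ Q (u + (s : ℝ) • x) (u + (s : ℝ) • x) + s * (∑ i, p i * Q (v i) (v i) - Q x x) := by
  induction s generalizing u with
  | zero => simpa using h 0 rfl
  | succ s ih =>
    -- Condition on the first draw: it is absorbed into the offset `u`, and the other `s` draws fall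
    -- under the induction hypothesis. Averaging with weights `p i` follows.
    have key : ∀ i, 0 ≤ Q (u + v i + (s : ℝ) • x) (u + v i + (s : ℝ) • x)
        + s * (∑ i, p i * Q (v i) (v i) - Q x x) := by
      intro i
      refine ih (u + v i) fun t ht => ?_
      have := h (i ::ₘ t) (by simp [ht])
      simpa [add_assoc] using this
    have hsum := Finset.sum_nonneg fun i (_ : i ∈ Finset.univ) => mul_nonneg (hp i) (key i)
    set V := ∑ i, p i * Q (v i) (v i) - Q x x with hV
    have e1 : ∑ i, p i * Q (v i) x = Q x x := by
      nth_rewrite 2 [← hx]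
      simp
    have e2 : ∑ i, p i * Q x (v i) = Q x x := by
      nth_rewrite 3 [← hx]
      simp
    have e3 : ∑ i, p i * Q u (v i) = Q u x := by
      rw [← hx]; simp
    have e4 : ∑ i, p i * Q (v i) u = Q x u := by
      rw [← hx]; simp
    have e0 : ∀ i, p i * (Q (u + v i + (s : ℝ) • x) (u + v i + (s : ℝ) • x) + s * V) =
        p i * (Q u u + s * Q u x + s * Q x u + s * s * Q x x + s * V) + p i * Q u (v i)
        + p i * Q (v i) u + p i * Q (v i) (v i) + s * (p i * Q (v i) x)
        + s * (p i * Q x (v i)) := by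
      intro i
      simp only [map_add, map_smul, LinearMap.add_apply, LinearMap.smul_apply, smul_eq_mul]
      ring
    simp only [e0, Finset.sum_add_distrib, ← Finset.mul_sum, ← Finset.sum_mul, e1, e2, e3, e4,
      hp1] at hsum
    have e5 : Q (u + ((s + 1 : ℕ) : ℝ) • x) (u + ((s + 1 : ℕ) : ℝ) • x) =
        Q u u + (s + 1) * Q u x + (s + 1) * Q x u + (s + 1) * (s + 1) * Q x x := by
      simp only [map_add, map_smul, LinearMap.add_apply, LinearMap.smul_apply, smul_eq_mul]
      push_cast
      ring
    rw [e5]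
    push_cast
    linarith

/-- For `s + 1` independent draws with mean `x`, the expectation of `Q` at their sum is `(s + 1) *
(s * Q x x + E Q(v, v))`: each draw pairs with `s` others and once with itself. Homogeneity removes
the normalisation of the weights. `Q` may be indefinite. -/
theorem maurey {ι E : Type*} [Fintype ι] [AddCommGroup E] [Module ℝ E]
    (Q : LinearMap.BilinForm ℝ E) (p : ι → ℝ) (hp : ∀ i, 0 ≤ p i) (v : ι → E) (s : ℕ)
    (h : ∀ t : Multiset ι, t.card = s + 1 → 0 ≤ Q (t.map v).sum (t.map v).sum) :
    0 ≤ s * Q (∑ i, p i • v i) (∑ i, p i • v i)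
      + (∑ i, p i) * ∑ i, p i * Q (v i) (v i) := by
  rcases (Finset.sum_nonneg fun i (_ : i ∈ Finset.univ) => hp i).eq_or_lt with h0 | hN
  · have hz : ∀ i, p i = 0 := fun i =>
      (Finset.sum_eq_zero_iff_of_nonneg fun i _ => hp i).1 h0.symm i (Finset.mem_univ i)
    simp [hz]
  · set N := ∑ i, p i with hNdef
    have key := maurey_aux Q (fun i => p i / N) (fun i => div_nonneg (hp i) hN.le)
      (by rw [← Finset.sum_div]; exact div_self hN.ne') v _ rfl (s + 1) 0 (by simpa using h)
    have e : ∑ i, (p i / N) • v i = N⁻¹ • ∑ i, p i • v i := by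
      rw [Finset.smul_sum]
      exact Finset.sum_congr rfl fun i _ => by rw [smul_smul, div_eq_inv_mul]
    have e' : ∑ i, p i / N * Q (v i) (v i) = N⁻¹ * ∑ i, p i * Q (v i) (v i) := by
      rw [Finset.mul_sum]
      exact Finset.sum_congr rfl fun i _ => by ring
    rw [e, e'] at key
    simp only [zero_add, map_smul, LinearMap.smul_apply, smul_eq_mul] at key
    push_cast at key
    have hs : (0 : ℝ) < s + 1 := by positivity
    have : (s + 1) / N ^ 2 * (s * Q (∑ i, p i • v i) (∑ i, p i • v i)
      + N * ∑ i, p i * Q (v i) (v i)) ≥ 0 := by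
      refine key.trans_eq ?_
      field_simp
      ring
    exact nonneg_of_mul_nonneg_right this (by positivity)

/-- The signed basis vectors `± e_j`. -/
def signedBasis (d : ℕ) (q : Fin d × Bool) : Fin d → ℝ :=
  Pi.single q.1 (if q.2 then 1 else -1)

/-- If a sign matrix does not shrink sums of `s + 1` signed basis vectors too much, then it is
bounded from below up to an `ℓ₁` term. -/
theorem lower_bound_of_signedBasis {n d s : ℕ} (B : Matrix (Fin n) (Fin d) ℝ)
    (hB : ∀ i j, B i j = 1 ∨ B i j = -1)
    (h : ∀ t : Multiset (Fin d × Bool), t.card = s + 1 →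
      (n : ℝ) / 2 * ((t.map (signedBasis d)).sum ⬝ᵥ (t.map (signedBasis d)).sum) ≤
        (B *ᵥ (t.map (signedBasis d)).sum) ⬝ᵥ (B *ᵥ (t.map (signedBasis d)).sum))
    (x : Fin d → ℝ) :
    (s : ℝ) * (n / 2 * (x ⬝ᵥ x)) ≤ s * ((B *ᵥ x) ⬝ᵥ (B *ᵥ x)) + (∑ j, |x j|) ^ 2 * (n / 2) := by
  set Q : LinearMap.BilinForm ℝ (Fin d → ℝ) := Matrix.toBilin' (Bᵀ * B - ((n : ℝ) / 2) • 1) with hQ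
  have hQa : ∀ z, Q z z = (B *ᵥ z) ⬝ᵥ (B *ᵥ z) - n / 2 * (z ⬝ᵥ z) := by
    intro z
    rw [hQ, Matrix.toBilin'_apply', Matrix.sub_mulVec, dotProduct_sub, Matrix.smul_mulVec,
      dotProduct_smul, Matrix.one_mulVec, smul_eq_mul, ← Matrix.mulVec_mulVec,
      Matrix.dotProduct_mulVec, Matrix.vecMul_transpose]
  have hsq : ∀ i j, B i j * B i j = 1 := by
    intro i j
    rcases hB i j with h | h <;> rw [h] <;> norm_num
  -- Every column of a sign matrix has squared norm exactly `n`.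
  have hQe : ∀ q, Q (signedBasis d q) (signedBasis d q) = n / 2 := by
    rintro ⟨j, b⟩
    rw [hQa]
    have h1 : (Pi.single j 1 : Fin d → ℝ) ⬝ᵥ Pi.single j 1 = 1 := by simp
    have h2 : (B *ᵥ Pi.single j 1) ⬝ᵥ (B *ᵥ Pi.single j 1) = n := by
      simp [dotProduct, hsq]
    cases b
    · simp only [signedBasis, Bool.false_eq_true, if_false, Pi.single_neg, Matrix.mulVec_neg,
        neg_dotProduct_neg, h1, h2]
      ring
    · simp only [signedBasis, if_true, h1, h2]
      ring
  -- Positive and negative parts of `x` as weights: the weighted sum is `x` and the total mass is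
  -- its ℓ₁ norm.
  have key := maurey Q (fun q => if q.2 then max (x q.1) 0 else max (-x q.1) 0)
    (fun q => by split_ifs <;> exact le_max_right _ _) (signedBasis d) s
    (fun t ht => by rw [hQa]; linarith [h t ht])
  have e1 : ∑ q : Fin d × Bool, (if q.2 then max (x q.1) 0 else max (-x q.1) 0) • signedBasis d q
      = x := by
    rw [Fintype.sum_prod_type]
    have : ∀ j, ∑ b : Bool, (if b then max (x j) 0 else max (-x j) 0) • signedBasis d (j, b)
        = Pi.single j (x j) := by
      intro j
      rw [Fintype.sum_bool]
      simp only [signedBasis, if_true, Bool.false_eq_true, if_false, ← Pi.single_smul,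
        ← Pi.single_add]
      congr 1
      rcases le_total 0 (x j) with h0 | h0 <;> simp [h0]
    simp only [this]
    exact Finset.univ_sum_single x
  have e2 : ∑ q : Fin d × Bool, (if q.2 then max (x q.1) 0 else max (-x q.1) 0)
      = ∑ j, |x j| := by
    rw [Fintype.sum_prod_type]
    refine Finset.sum_congr rfl fun j _ => ?_
    rw [Fintype.sum_bool]
    rcases le_total 0 (x j) with h0 | h0 <;> simp [h0, abs_of_nonneg, abs_of_nonpos]
  simp only [hQe, ← Finset.sum_mul, e2] at key
  rw [e1, hQa] at key
  nlinarith [key]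

/-- On the cone `‖x‖₁² ≤ 4 k ‖x‖₂²` the matrix is bounded from below. -/
theorem cone_lower_bound {n d k : ℕ} (hk : 0 < k) (B : Matrix (Fin n) (Fin d) ℝ)
    (hB : ∀ i j, B i j = 1 ∨ B i j = -1)
    (h : ∀ t : Multiset (Fin d × Bool), t.card = 8 * k + 1 →
      (n : ℝ) / 2 * ((t.map (signedBasis d)).sum ⬝ᵥ (t.map (signedBasis d)).sum) ≤
        (B *ᵥ (t.map (signedBasis d)).sum) ⬝ᵥ (B *ᵥ (t.map (signedBasis d)).sum))
    (x : Fin d → ℝ) (hx : (∑ j, |x j|) ^ 2 ≤ 4 * k * (x ⬝ᵥ x)) :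
    (n : ℝ) / 4 * (x ⬝ᵥ x) ≤ (B *ᵥ x) ⬝ᵥ (B *ᵥ x) := by
  -- With `s = 8 k` the ℓ₁ term is at most `2 k n ‖x‖²`, half of the main term `4 k n ‖x‖²`.
  have h1 := lower_bound_of_signedBasis B hB h x
  push_cast at h1
  have h2 : (∑ j, |x j|) ^ 2 * ((n : ℝ) / 2) ≤ 4 * k * (x ⬝ᵥ x) * (n / 2) := by gcongr
  have hk' : (0 : ℝ) < k := by exact_mod_cast hk
  have h3 : (8 * k : ℝ) * ((n : ℝ) / 4 * (x ⬝ᵥ x)) ≤ 8 * k * ((B *ᵥ x) ⬝ᵥ (B *ᵥ x)) := by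
    linarith
  exact le_of_mul_le_mul_left h3 (by positivity)

/-! ### Moments of Rademacher sums and the lower tail -/

/-- A weighted Rademacher sum is bounded. -/
theorem abs_sum_mul_sign_le {ι Ω : Type*} (b : ι → Ω → ℝ) (hs : ∀ i ω, b i ω = 1 ∨ b i ω = -1)
    (z : ι → ℝ) (T : Finset ι) (ω : Ω) : |∑ i ∈ T, z i * b i ω| ≤ ∑ i ∈ T, |z i| := by
  refine (Finset.abs_sum_le_sum_abs _ _).trans (Finset.sum_le_sum fun i _ => ?_)
  rcases hs i ω with h | h <;> simp [h]

section Moments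

variable {Ω : Type*} [MeasurableSpace Ω] {P : Measure Ω} [IsProbabilityMeasure P]

/-- The second moment, and a bound of the fourth moment, of a weighted Rademacher sum. -/
theorem rademacher_moments {ι : Type*} (b : ι → Ω → ℝ) (hm : ∀ i, Measurable (b i))
    (hs : ∀ i ω, b i ω = 1 ∨ b i ω = -1) (h0 : ∀ i, ∫ ω, b i ω ∂P = 0) (hi : iIndepFun b P)
    (z : ι → ℝ) (T : Finset ι) :
    ∫ ω, (∑ i ∈ T, z i * b i ω) ^ 2 ∂P = ∑ i ∈ T, z i ^ 2 ∧
      ∫ ω, (∑ i ∈ T, z i * b i ω) ^ 4 ∂P ≤ 3 * (∑ i ∈ T, z i ^ 2) ^ 2 := by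
  classical
  induction T using Finset.induction_on with
  | empty => simp
  | insert i T hiT ih =>
    obtain ⟨ih2, ih4⟩ := ih
    set X : Ω → ℝ := fun ω => ∑ j ∈ T, z j * b j ω with hX
    set Y : Ω → ℝ := fun ω => z i * b i ω with hY
    have hXm : Measurable X := by fun_prop
    have hYm : Measurable Y := (hm i).const_mul _
    have hXY : IndepFun X Y P := by
      have := (hi.comp (fun j x => z j * x) fun j => measurable_const_mul _).indepFun_finsetSum_of_notMem
        (fun j => (hm j).const_mul _) hiT
      convert! this using 1
      ext ω
      simp [hX]
    have hXb : ∀ ω, |X ω| ≤ ∑ j ∈ T, |z j| := abs_sum_mul_sign_le b hs z T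
    have hYb : ∀ ω, |Y ω| ≤ |z i| := fun ω => by
      rcases hs i ω with h | h <;> simp [hY, h]
    have hint : ∀ k l : ℕ, Integrable (fun ω => X ω ^ k * Y ω ^ l) P := fun k l =>
      Integrable.of_bound (by fun_prop) ((∑ j ∈ T, |z j|) ^ k * |z i| ^ l)
        (Filter.Eventually.of_forall fun ω => by
          rw [Real.norm_eq_abs, abs_mul, abs_pow, abs_pow]
          have := hXb ω
          have := hYb ω
          gcongr)
    have hY0 : ∫ ω, Y ω ∂P = 0 := by rw [hY, integral_const_mul, h0, mul_zero]
    have hodd : ∀ k : ℕ, ∫ ω, X ω ^ k * Y ω ∂P = 0 := by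
      intro k
      have := (hXY.comp (φ := fun x => x ^ k) (ψ := id) (by fun_prop)
        measurable_id).integral_fun_mul_eq_mul_integral
        (by fun_prop) (by fun_prop)
      simp only [Function.comp_apply, id] at this
      rw [this]
      simp [hY0]
    have hY2 : ∀ ω, Y ω ^ 2 = z i ^ 2 := fun ω => by
      rcases hs i ω with h | h <;> simp [hY, h]
    have hi1 := hint 1 1
    have hi2 := hint 2 0
    have hi3 := hint 3 1
    have hi4 := hint 4 0
    have ho1 := hodd 1
    simp only [pow_one, pow_zero, mul_one] at hi1 hi2 hi3 hi4 ho1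
    have e2 : ∀ ω, (∑ j ∈ insert i T, z j * b j ω) ^ 2 = X ω ^ 2 + (2 * (X ω * Y ω) + z i ^ 2) := by
      intro ω
      rw [Finset.sum_insert hiT, ← hY2 ω]
      ring
    have e4 : ∀ ω, (∑ j ∈ insert i T, z j * b j ω) ^ 4 =
        X ω ^ 4 + (4 * (X ω ^ 3 * Y ω) + (6 * z i ^ 2 * X ω ^ 2 +
          (4 * z i ^ 2 * (X ω * Y ω) + z i ^ 4))) := by
      intro ω
      rw [Finset.sum_insert hiT, show z i ^ 4 = (z i ^ 2) ^ 2 by ring, ← hY2 ω]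
      ring
    have h2 : ∫ ω, X ω ^ 2 ∂P = ∑ j ∈ T, z j ^ 2 := ih2
    have h4 : ∫ ω, X ω ^ 4 ∂P ≤ 3 * (∑ j ∈ T, z j ^ 2) ^ 2 := ih4
    simp only [e2, e4]
    constructor
    · rw [integral_add hi2 (by fun_prop), integral_add (by fun_prop) (by fun_prop),
        integral_const_mul, ho1, h2, Finset.sum_insert hiT]
      simp
      ring
    · rw [integral_add hi4 (by fun_prop), integral_add (by fun_prop) (by fun_prop),
        integral_add (by fun_prop) (by fun_prop), integral_add (by fun_prop) (by fun_prop),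
        integral_const_mul, integral_const_mul, integral_const_mul, ho1, hodd 3, h2,
        Finset.sum_insert hiT]
      simp only [integral_const, probReal_univ, one_smul]
      -- With `V` the old sum of squares, the new fourth moment is at most `3 V² + 6 V z² + z⁴`, and
      -- `3 (V + z²)²` exceeds this by `2 z⁴`.
      have := sq_nonneg (z i ^ 2)
      nlinarith [h4]

/-- `(1 - u + u²/2) (1 + u + u²/2) = 1 + u⁴/4 ≥ 1`, and the second factor is at most `exp u`. -/
theorem exp_neg_le_quadratic {u : ℝ} (hu : 0 ≤ u) : Real.exp (-u) ≤ 1 - u + u ^ 2 / 2 := by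
  have h1 := Real.quadratic_le_exp_of_nonneg hu
  have h2 : 0 < 1 - u + u ^ 2 / 2 := by nlinarith [sq_nonneg (u - 1)]
  rw [Real.exp_neg, inv_le_comm₀ (Real.exp_pos _) h2]
  refine le_trans ?_ h1
  rw [inv_le_iff_one_le_mul₀ h2]
  nlinarith [sq_nonneg (u ^ 2)]

/-- The quadratic bound for the exponential reduces this to the two moments: `1 - 1/6 + 3/72 = 1 -
1/8`. -/
theorem integral_exp_neg_rademacher_sq_le {ι : Type*} (b : ι → Ω → ℝ) (hm : ∀ i, Measurable (b i))
    (hs : ∀ i ω, b i ω = 1 ∨ b i ω = -1) (h0 : ∀ i, ∫ ω, b i ω ∂P = 0) (hi : iIndepFun b P)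
    (z : ι → ℝ) (T : Finset ι) (hz : 0 < ∑ i ∈ T, z i ^ 2) :
    ∫ ω, Real.exp (-((∑ i ∈ T, z i * b i ω) ^ 2 / (6 * ∑ i ∈ T, z i ^ 2))) ∂P
      ≤ Real.exp (-(1 / 8)) := by
  obtain ⟨h2, h4⟩ := rademacher_moments b hm hs h0 hi z T
  set X : Ω → ℝ := fun ω => ∑ j ∈ T, z j * b j ω with hX
  set V := ∑ i ∈ T, z i ^ 2 with hV
  have hXm : Measurable X := by fun_prop
  have hXb : ∀ ω, |X ω| ≤ ∑ j ∈ T, |z j| := abs_sum_mul_sign_le b hs z T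
  have hint : ∀ k : ℕ, Integrable (fun ω => X ω ^ k) P := fun k =>
    Integrable.of_bound (by fun_prop) ((∑ j ∈ T, |z j|) ^ k)
      (Filter.Eventually.of_forall fun ω => by
        rw [Real.norm_eq_abs, abs_pow]
        have := hXb ω
        gcongr)
  have hi2 := hint 2
  have hi4 := hint 4
  calc ∫ ω, Real.exp (-(X ω ^ 2 / (6 * V))) ∂P
      ≤ ∫ ω, (1 - 1 / (6 * V) * X ω ^ 2 + 1 / (72 * V ^ 2) * X ω ^ 4) ∂P := by
        refine integral_mono_of_nonneg (Filter.Eventually.of_forall fun ω => (Real.exp_pos _).le)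
          (by fun_prop) (Filter.Eventually.of_forall fun ω => ?_)
        refine (exp_neg_le_quadratic (by positivity)).trans_eq ?_
        field_simp
        ring
    _ = 1 - 1 / (6 * V) * V + 1 / (72 * V ^ 2) * ∫ ω, X ω ^ 4 ∂P := by
        rw [integral_add (by fun_prop) (by fun_prop), integral_sub (by fun_prop) (by fun_prop),
          integral_const_mul, integral_const_mul, h2]
        simp
    _ ≤ 1 - 1 / (6 * V) * V + 1 / (72 * V ^ 2) * (3 * V ^ 2) := by
        have : 0 ≤ 1 / (72 * V ^ 2) := by positivity
        gcongr
    _ = -(1 / 8) + 1 := by field_simp; norm_num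
    _ ≤ Real.exp (-(1 / 8)) := Real.add_one_le_exp _

variable {n d : ℕ} {B : Ω → Matrix (Fin n) (Fin d) ℝ}

theorem IsRademacherMatrix.integral_eq_zero (hB : IsRademacherMatrix P B) (i : Fin n)
    (j : Fin d) : ∫ ω, B ω i j ∂P = 0 := by
  have hm1 : MeasurableSet {ω | B ω i j = 1} := hB.measurable i j (measurableSet_singleton 1)
  have hm2 : MeasurableSet {ω | B ω i j = -1} := hB.measurable i j (measurableSet_singleton (-1))
  have e : ∀ ω, B ω i j = {ω | B ω i j = 1}.indicator (fun _ => (1 : ℝ)) ω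
      - {ω | B ω i j = -1}.indicator (fun _ => (1 : ℝ)) ω := by
    intro ω
    rcases hB.mem_signs ω i j with h | h <;> norm_num [Set.indicator, h]
  rw [integral_congr_ae (ae_of_all P e), integral_sub ((integrable_const _).indicator hm1) ((integrable_const _).indicator hm2),
    integral_indicator_const _ hm1, integral_indicator_const _ hm2, hB.prob_pos, hB.prob_neg]
  simp

/-- The rows are independent: expectations of products over the rows factorize. -/
theorem IsRademacherMatrix.integral_prod_rows (hB : IsRademacherMatrix P B)
    (F : (Fin d → ℝ) → ℝ) (hF : Measurable F) (T : Finset (Fin n)) :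
    ∫ ω, ∏ i ∈ T, F (B ω i) ∂P = ∏ i ∈ T, ∫ ω, F (B ω i) ∂P := by
  classical
  have hrow : ∀ i, Measurable fun ω => B ω i := fun i => measurable_pi_lambda _ (hB.measurable i)
  induction T using Finset.induction_on with
  | empty => simp
  | insert i T hiT ih =>
    have hdisj : Disjoint ((T ×ˢ Finset.univ : Finset (Fin n × Fin d)))
        (({i} : Finset (Fin n)) ×ˢ Finset.univ) := by
      rw [Finset.disjoint_product]
      exact Or.inl (Finset.disjoint_singleton_right.2 hiT)
    have hind := hB.indep.indepFun_finset _ _ hdisj fun q => hB.measurable q.1 q.2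
    have hFrow : ∀ k, Measurable fun ω => F (B ω k) := fun k => hF.comp (hrow k)
    have hind' : IndepFun (fun ω => ∏ k ∈ T, F (B ω k)) (fun ω => F (B ω i)) P := by
      have := hind.comp
        (φ := fun w => ∏ k : T, F fun j => w ⟨(k.1, j), by simp [k.2]⟩)
        (ψ := fun w => F fun j => w ⟨(i, j), by simp⟩)
        (Finset.measurable_fun_prod _ fun k _ =>
          hF.comp (measurable_pi_lambda _ fun j => measurable_pi_apply _))
        (hF.comp (measurable_pi_lambda _ fun j => measurable_pi_apply _))
      convert! this using 1
      ext ω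
      exact (Finset.prod_coe_sort T fun k => F (B ω k)).symm
    simp_rw [Finset.prod_insert hiT]
    rw [← ih]
    simp_rw [mul_comm (F (B _ i))]
    rw [hind'.integral_fun_mul_eq_mul_integral
      (Finset.measurable_fun_prod _ fun k _ => hFrow k).aestronglyMeasurable
      (hFrow i).aestronglyMeasurable, mul_comm]

/-- The lower tail of `‖B z‖²`. -/
theorem IsRademacherMatrix.lower_tail (hB : IsRademacherMatrix P B) (z : Fin d → ℝ) :
    P.real {ω | (B ω *ᵥ z) ⬝ᵥ (B ω *ᵥ z) < n / 2 * (z ⬝ᵥ z)} ≤ Real.exp (-(n / 24)) := by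
  set V := ∑ j, z j ^ 2 with hV
  have hzz : z ⬝ᵥ z = V := Finset.sum_congr rfl fun j _ => by ring
  have hV0 : 0 ≤ V := Finset.sum_nonneg fun j _ => sq_nonneg _
  rcases hV0.eq_or_lt with h0 | hVpos
  · have : {ω | (B ω *ᵥ z) ⬝ᵥ (B ω *ᵥ z) < n / 2 * (z ⬝ᵥ z)} = ∅ := by
      ext ω
      simp only [Set.mem_ofPred_eq, Set.mem_empty_iff_false, iff_false, not_lt, hzz, ← h0, mul_zero]
      exact Finset.sum_nonneg fun i _ => mul_self_nonneg _
    rw [this, measureReal_empty]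
    exact (Real.exp_pos _).le
  set F : (Fin d → ℝ) → ℝ := fun r => Real.exp (-((∑ j, z j * r j) ^ 2 / (6 * V))) with hFdef
  have hF : Measurable F := by fun_prop
  set G : Ω → ℝ := fun ω => ∑ i, (∑ j, z j * B ω i j) ^ 2 / V with hG
  have hGm : Measurable G := by
    have := hB.measurable
    fun_prop
  have hexp : ∀ ω, Real.exp (-(1 / 6) * G ω) = ∏ i, F (B ω i) := by
    intro ω
    rw [← Real.exp_sum, hG, Finset.mul_sum]
    congr 1
    refine Finset.sum_congr rfl fun i _ => ?_
    field_simp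
  have hG0 : ∀ ω, 0 ≤ G ω := fun ω => Finset.sum_nonneg fun i _ => by positivity
  have hint : Integrable (fun ω => Real.exp (-(1 / 6) * G ω)) P :=
    Integrable.of_bound (by fun_prop) 1 (Filter.Eventually.of_forall fun ω => by
      rw [Real.norm_eq_abs, Real.abs_exp, Real.exp_le_one_iff]
      linarith [hG0 ω])
  -- The parameter `t = 1/6` minimises `t/2 - t + 3 t²/2`, the exponent per row in the Chernoff
  -- bound at level `n/2`; the minimum is `-1/24`.
  have hmgf : mgf G P (-(1 / 6)) ≤ Real.exp (-(n / 8)) := by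
    unfold mgf
    simp_rw [hexp]
    rw [hB.integral_prod_rows F hF]
    calc ∏ i : Fin n, ∫ ω, F (B ω i) ∂P ≤ ∏ _i : Fin n, Real.exp (-(1 / 8)) := by
          refine Finset.prod_le_prod (fun i _ => integral_nonneg fun ω => (Real.exp_pos _).le)
            fun i _ => ?_
          exact integral_exp_neg_rademacher_sq_le (fun j ω => B ω i j) (hB.measurable i)
            (fun j ω => hB.mem_signs ω i j) (hB.integral_eq_zero i)
            (hB.indep.precomp (g := fun j => (i, j)) fun _ _ h => (Prod.ext_iff.1 h).2)
            z Finset.univ hVpos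
      _ = Real.exp (-(n / 8)) := by
          rw [Finset.prod_const, Finset.card_univ, Fintype.card_fin, ← Real.exp_nat_mul]
          congr 1
          ring
  have hsub : {ω | (B ω *ᵥ z) ⬝ᵥ (B ω *ᵥ z) < n / 2 * (z ⬝ᵥ z)} ⊆ {ω | G ω ≤ n / 2} := by
    intro ω hω
    simp only [Set.mem_ofPred_eq, hzz] at hω ⊢
    rw [hG]
    simp only [← Finset.sum_div]
    rw [div_le_iff₀ hVpos]
    refine le_of_eq_of_le ?_ hω.le
    refine Finset.sum_congr rfl fun i _ => ?_
    rw [sq, Matrix.mulVec, dotProduct]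
    simp only [mul_comm]
  calc P.real {ω | (B ω *ᵥ z) ⬝ᵥ (B ω *ᵥ z) < n / 2 * (z ⬝ᵥ z)}
      ≤ P.real {ω | G ω ≤ n / 2} := measureReal_mono hsub
    _ ≤ Real.exp (-(-(1 / 6)) * (n / 2)) * mgf G P (-(1 / 6)) :=
        measure_le_le_exp_mul_mgf _ (by norm_num) hint
    _ ≤ Real.exp (-(-(1 / 6)) * (n / 2)) * Real.exp (-(n / 8)) := by gcongr
    _ = Real.exp (-(n / 24)) := by
        rw [← Real.exp_add]
        congr 1
        ring

end Moments

/-! ### Union bound over sums of signed basis vectors -/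

theorem multichoose_le_exp {d k : ℕ} (hk : 0 < k) (hkd : k ≤ d) :
    ((2 * d).multichoose (8 * k + 1) : ℝ) ≤ Real.exp (9 * k * (Real.log (d / k) + 2)) := by
  have hk' : (0 : ℝ) < k := by exact_mod_cast hk
  have hkd' : (k : ℝ) ≤ d := by exact_mod_cast hkd
  have hd' : (0 : ℝ) < d := hk'.trans_le hkd'
  have hlog : 0 ≤ Real.log (d / k) := Real.log_nonneg ((one_le_div hk').2 hkd')
  set s := 8 * k + 1 with hs
  have hs' : (s : ℝ) = 8 * k + 1 := by simp [hs]
  have hs0 : (0 : ℝ) < s := by rw [hs']; positivity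
  -- Here `s - 1 = 8 k ≤ 8 d`, which gives `10 d`.
  have h1 : (((2 * d).multichoose s : ℕ) : ℝ) ≤ (10 * d) ^ s / s.factorial := by
    rw [Nat.multichoose_eq]
    refine (Nat.choose_le_pow_div (α := ℝ) s _).trans ?_
    gcongr
    have : 2 * d + s - 1 ≤ 10 * d := by omega
    exact_mod_cast this
  have h2 : (s : ℝ) ^ s / s.factorial ≤ Real.exp s := Real.pow_div_factorial_le_exp _ hs0.le s
  have h3 : (10 * d : ℝ) / s ≤ Real.exp 1 * (d / k) := by
    have : (2 : ℝ) ≤ Real.exp 1 := by linarith [Real.add_one_le_exp (1 : ℝ)]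
    calc (10 * d : ℝ) / s ≤ 10 * d / (8 * k) := by
          apply div_le_div_of_nonneg_left <;> first | positivity | (rw [hs']; linarith)
      _ = 10 / 8 * (d / k) := by field_simp
      _ ≤ Real.exp 1 * (d / k) := by gcongr; linarith
  calc (((2 * d).multichoose s : ℕ) : ℝ) ≤ (10 * d) ^ s / s.factorial := h1
    _ = (10 * d / s) ^ s * (s ^ s / s.factorial) := by rw [div_pow]; field_simp
    _ ≤ (Real.exp 1 * (d / k)) ^ s * Real.exp s := by gcongr
    _ = Real.exp (s * (Real.log (d / k) + 2)) := by
        have : (d : ℝ) / k = Real.exp (Real.log (d / k)) := (Real.exp_log (by positivity)).symm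
        rw [this, Real.log_exp, ← Real.exp_add, ← Real.exp_nat_mul, ← Real.exp_add]
        congr 1
        ring
    _ ≤ Real.exp (9 * k * (Real.log (d / k) + 2)) := by
        have : (1 : ℝ) ≤ k := by exact_mod_cast hk
        gcongr
        rw [hs']; linarith

/-- With high probability a Rademacher matrix is bounded from below at all sums of `8 k + 1` signed
basis vectors. -/
theorem IsRademacherMatrix.signedBasis_lower_bound {Ω : Type*} [MeasurableSpace Ω] {P : Measure Ω}
    [IsProbabilityMeasure P] {n d k : ℕ} {B : Ω → Matrix (Fin n) (Fin d) ℝ}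
    (hB : IsRademacherMatrix P B) (hk : 0 < k) (hkd : k ≤ d)
    (hn : 432 * k * (Real.log (d / k) + 2) ≤ n) :
    1 - Real.exp (-(n / 48)) ≤ P.real {ω | ∀ t : Multiset (Fin d × Bool), t.card = 8 * k + 1 →
      (n : ℝ) / 2 * ((t.map (signedBasis d)).sum ⬝ᵥ (t.map (signedBasis d)).sum) ≤
        (B ω *ᵥ (t.map (signedBasis d)).sum) ⬝ᵥ (B ω *ᵥ (t.map (signedBasis d)).sum)} := by
  set A := {ω | ∀ t : Multiset (Fin d × Bool), t.card = 8 * k + 1 →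
      (n : ℝ) / 2 * ((t.map (signedBasis d)).sum ⬝ᵥ (t.map (signedBasis d)).sum) ≤
        (B ω *ᵥ (t.map (signedBasis d)).sum) ⬝ᵥ (B ω *ᵥ (t.map (signedBasis d)).sum)} with hA
  -- Multisets of a fixed size form a finite type; ignoring the order of the draws gains the
  -- factorial that keeps the count near `(d/k)^s`.
  set Z : Sym (Fin d × Bool) (8 * k + 1) → Fin d → ℝ := fun t => (t.1.map (signedBasis d)).sum
  have hsub : Aᶜ ⊆ ⋃ t, {ω | (B ω *ᵥ Z t) ⬝ᵥ (B ω *ᵥ Z t) < n / 2 * (Z t ⬝ᵥ Z t)} := by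
    intro ω hω
    simp only [hA, Set.mem_compl_iff, Set.mem_ofPred_eq, not_forall, not_le] at hω
    obtain ⟨t, ht, h⟩ := hω
    exact Set.mem_iUnion.2 ⟨⟨t, ht⟩, h⟩
  have hcard : (Fintype.card (Sym (Fin d × Bool) (8 * k + 1)) : ℝ) ≤ Real.exp (n / 48) := by
    rw [Sym.card_sym_eq_multichoose, Fintype.card_prod, Fintype.card_fin, Fintype.card_bool,
      mul_comm d 2]
    refine (multichoose_le_exp hk hkd).trans (Real.exp_le_exp.2 ?_)
    linarith
  have hbad : P.real Aᶜ ≤ Real.exp (-(n / 48)) := by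
    calc P.real Aᶜ ≤ P.real (⋃ t, {ω | (B ω *ᵥ Z t) ⬝ᵥ (B ω *ᵥ Z t) < n / 2 * (Z t ⬝ᵥ Z t)}) :=
          measureReal_mono hsub
      _ ≤ ∑ t, P.real {ω | (B ω *ᵥ Z t) ⬝ᵥ (B ω *ᵥ Z t) < n / 2 * (Z t ⬝ᵥ Z t)} :=
          measureReal_iUnion_fintype_le _
      _ ≤ ∑ _t : Sym (Fin d × Bool) (8 * k + 1), Real.exp (-(n / 24)) :=
          Finset.sum_le_sum fun t _ => hB.lower_tail (Z t)
      _ = Fintype.card (Sym (Fin d × Bool) (8 * k + 1)) * Real.exp (-(n / 24)) := by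
          rw [Finset.sum_const, Finset.card_univ, nsmul_eq_mul]
      _ ≤ Real.exp (n / 48) * Real.exp (-(n / 24)) := by gcongr
      _ = Real.exp (-(n / 48)) := by
          rw [← Real.exp_add]
          congr 1
          ring
  -- Subadditivity holds for arbitrary sets, so measurability of `A` is not required.
  have hone : 1 ≤ P.real A + P.real Aᶜ := by
    have := measureReal_union_le (μ := P) A Aᶜ
    rwa [Set.union_compl_self, probReal_univ] at this
  linarith

/-! ### Stable recovery by ℓ₁ minimisation -/

theorem l1_norm_toLp {d : ℕ} (z : Fin d → ℝ) : ‖WithLp.toLp 1 z‖ = ∑ j, |z j| := by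
  rw [PiLp.norm_eq_of_L1]
  rfl

theorem l2_norm_toLp_sq {d : ℕ} (z : Fin d → ℝ) : ‖WithLp.toLp 2 z‖ ^ 2 = z ⬝ᵥ z := by
  rw [PiLp.norm_sq_eq_of_L2]
  exact Finset.sum_congr rfl fun j _ => by
    rw [Real.norm_eq_abs, sq_abs, sq]

/-- (P1) has a solution as soon as it has a feasible point. -/
theorem exists_isP1Solution {n d : ℕ} {ν : ℝ} {y : Fin n → ℝ} {B : Matrix (Fin n) (Fin d) ℝ}
    {z₀ : Fin d → ℝ} (h : ‖WithLp.toLp 2 (y - B *ᵥ z₀)‖ ≤ ν) : ∃ z, IsP1Solution ν y B z := by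
  have hcont : Continuous fun w : PiLp 1 fun _ : Fin d => ℝ =>
      ‖WithLp.toLp 2 (y - B *ᵥ WithLp.ofLp w)‖ := by
    have h1 : Continuous fun w : PiLp 1 fun _ : Fin d => ℝ => y - B *ᵥ WithLp.ofLp w :=
      continuous_const.sub (Continuous.matrix_mulVec continuous_const (PiLp.continuous_ofLp 1 _))
    exact ((PiLp.continuous_toLp 2 _).comp h1).norm
  have hclosed : IsClosed {w : PiLp 1 fun _ : Fin d => ℝ |
      ‖WithLp.toLp 2 (y - B *ᵥ WithLp.ofLp w)‖ ≤ ν} := isClosed_le hcont continuous_const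
  obtain ⟨w, hw, hmin⟩ := continuous_norm.continuousOn.exists_isMinOn' hclosed
    (x₀ := WithLp.toLp 1 z₀) h
    (Filter.Eventually.filter_mono inf_le_left
      ((tendsto_norm_cocompact_atTop (E := PiLp 1 fun _ : Fin d => ℝ)).eventually_ge_atTop _))
  exact ⟨WithLp.ofLp w, hw, fun v hv => hmin (show WithLp.toLp 1 v ∈ _ from hv)⟩

/-- The difference of an `ℓ₁`-smaller vector and a vector supported on `S` lies in the cone of
vectors concentrated on `S`. -/
theorem l1_sq_le_of_l1_le {d : ℕ} {S : Finset (Fin d)} {z w : Fin d → ℝ}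
    (hw : ∀ j ∉ S, w j = 0) (h : ∑ j, |z j| ≤ ∑ j, |w j|) :
    (∑ j, |(z - w) j|) ^ 2 ≤ 4 * S.card * ((z - w) ⬝ᵥ (z - w)) := by
  set u := z - w with hu
  have hsplit : ∀ a : Fin d → ℝ, ∑ j, a j = ∑ j ∈ S, a j + ∑ j ∈ Sᶜ, a j := fun a =>
    (Finset.sum_add_sum_compl S a).symm
  have h1 : ∑ j ∈ Sᶜ, |w j| = 0 :=
    Finset.sum_eq_zero fun j hj => by rw [hw j (Finset.mem_compl.1 hj), abs_zero]
  have h2 : ∑ j ∈ Sᶜ, |z j| = ∑ j ∈ Sᶜ, |u j| :=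
    Finset.sum_congr rfl fun j hj => by
      rw [hu, Pi.sub_apply, hw j (Finset.mem_compl.1 hj), sub_zero]
  have h3 : ∑ j ∈ S, |w j| ≤ ∑ j ∈ S, |z j| + ∑ j ∈ S, |u j| := by
    rw [← Finset.sum_add_distrib]
    refine Finset.sum_le_sum fun j _ => ?_
    have := abs_sub_le (w j) (z j) 0
    rw [sub_zero, sub_zero, abs_sub_comm] at this
    rw [hu, Pi.sub_apply]
    linarith
  rw [hsplit, hsplit fun j => |w j|, h1, h2] at h
  -- Since `z = u` off `S`, minimality forces the ℓ₁ mass of `u` off `S` to be at most its mass on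
  -- `S`.
  have h4 : ∑ j, |u j| ≤ 2 * ∑ j ∈ S, |u j| := by
    rw [hsplit]
    linarith
  have h5 : (∑ j ∈ S, |u j|) ^ 2 ≤ S.card * ∑ j ∈ S, |u j| ^ 2 := sq_sum_le_card_mul_sum_sq
  have h6 : ∑ j ∈ S, |u j| ^ 2 ≤ u ⬝ᵥ u := by
    calc ∑ j ∈ S, |u j| ^ 2 ≤ ∑ j, |u j| ^ 2 :=
          Finset.sum_le_sum_of_subset_of_nonneg (Finset.subset_univ _) fun j _ _ => sq_nonneg _
      _ = u ⬝ᵥ u := Finset.sum_congr rfl fun j _ => by rw [sq_abs, sq]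
  calc (∑ j, |u j|) ^ 2 ≤ (2 * ∑ j ∈ S, |u j|) ^ 2 := by
        have : 0 ≤ ∑ j, |u j| := Finset.sum_nonneg fun j _ => abs_nonneg _
        gcongr
    _ = 4 * (∑ j ∈ S, |u j|) ^ 2 := by ring
    _ ≤ 4 * (S.card * (u ⬝ᵥ u)) := by
        have : (0 : ℝ) ≤ S.card := Nat.cast_nonneg _
        gcongr
        exact h5.trans (by gcongr)
    _ = _ := by ring

/-- Stable recovery by (P1) of a vector supported on `S`. -/
theorem abs_sub_le_of_isP1Solution {n d : ℕ} {S : Finset (Fin d)}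
    (hn : S.Nonempty → 0 < n)
    {B : Matrix (Fin n) (Fin d) ℝ}
    (hB : ∀ x : Fin d → ℝ, (∑ j, |x j|) ^ 2 ≤ 4 * S.card * (x ⬝ᵥ x) →
      (n : ℝ) / 4 * (x ⬝ᵥ x) ≤ (B *ᵥ x) ⬝ᵥ (B *ᵥ x))
    {ε : ℝ} (hε : 0 ≤ ε) {y : Fin n → ℝ} {z w : Fin d → ℝ} (hw : ∀ j ∉ S, w j = 0)
    (hyw : ‖WithLp.toLp 2 (y - B *ᵥ w)‖ ≤ 2 * ε * √n) (hz : IsP1Solution (2 * ε * √n) y B z)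
    (p : Fin d) : |z p - w p| ≤ 8 * ε := by
  have hl1 := hz.2 w hyw
  rw [l1_norm_toLp, l1_norm_toLp] at hl1
  have hcone := l1_sq_le_of_l1_le hw hl1
  -- For empty `S` the cone is `{0}`, so `z = w` even when `n = 0`.
  rcases S.eq_empty_or_nonempty with hS | hS
  · simp only [hS, Finset.card_empty, Nat.cast_zero, mul_zero, zero_mul] at hcone
    have h0 : ∑ j, |(z - w) j| = 0 := pow_eq_zero_iff two_ne_zero |>.1
      (le_antisymm hcone (sq_nonneg _))
    have h1 := (Finset.sum_eq_zero_iff_of_nonneg fun j _ => abs_nonneg _).1 h0 p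
      (Finset.mem_univ p)
    rw [Pi.sub_apply] at h1
    rw [h1]
    positivity
  have hlow := hB (z - w) hcone
  have hup : ‖WithLp.toLp 2 (B *ᵥ (z - w))‖ ≤ 4 * ε * √n := by
    have e : WithLp.toLp 2 (B *ᵥ (z - w)) =
        WithLp.toLp 2 (y - B *ᵥ w) - WithLp.toLp 2 (y - B *ᵥ z) := by
      rw [Matrix.mulVec_sub, ← WithLp.toLp_sub]
      congr 1
      abel
    rw [e]
    refine (norm_sub_le _ _).trans ?_
    linarith [hz.1]
  have hn' : (0 : ℝ) < n := by exact_mod_cast hn hS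
  have hup2 : (B *ᵥ (z - w)) ⬝ᵥ (B *ᵥ (z - w)) ≤ n * (16 * ε ^ 2) := by
    rw [← l2_norm_toLp_sq]
    calc _ ≤ (4 * ε * √n) ^ 2 := by gcongr
      _ = _ := by rw [mul_pow, Real.sq_sqrt hn'.le]; ring
  -- The constant is `(4 ε √n)² / (n/4) = 64 ε²`.
  have h1 : (z - w) ⬝ᵥ (z - w) ≤ (8 * ε) ^ 2 := by
    refine le_of_mul_le_mul_left ?_ (show (0 : ℝ) < n / 4 by positivity)
    linarith
  have h2 : (z p - w p) ^ 2 ≤ (z - w) ⬝ᵥ (z - w) := by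
    rw [sq]
    exact Finset.single_le_sum (f := fun j => (z - w) j * (z - w) j)
      (fun j _ => mul_self_nonneg _) (Finset.mem_univ p)
  exact abs_le_of_sq_le_sq (h2.trans h1) (by positivity)

/-! ### Measurements of the additive model and the grid -/

/-- Without noise the differences of the answers are linear measurements of the vector of the
values `φ p c`, `p ∈ S`. -/
theorem IsSparseAdditiveModel.sub_eq_mulVec {n d : ℕ} {f : (Fin d → ℝ) → ℝ} {S : Finset (Fin d)}
    {μ : ℝ} {φ : Fin d → ℝ → ℝ} {L α D : ℝ} (hf : IsSparseAdditiveModel f S μ φ L α D)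
    {B : Matrix (Fin n) (Fin d) ℝ} (hB : ∀ i j, B i j = 1 ∨ B i j = -1) {c : ℝ}
    (hc : c ∈ Set.Icc (-1 : ℝ) 1) (i : Fin n) :
    f (plusPoint (fun _ => c) (B i)) - f (minusPoint (fun _ => c) (B i)) =
      (B *ᵥ fun p => if p ∈ S then φ p c else 0) i := by
  have h0 : (0 : ℝ) ∈ Set.Icc (-1 : ℝ) 1 := by norm_num
  rw [hf.repr _ fun p => by unfold plusPoint; split_ifs <;> assumption,
    hf.repr _ fun p => by unfold minusPoint; split_ifs <;> assumption, add_sub_add_left_eq_sub,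
    ← Finset.sum_sub_distrib, Matrix.mulVec, dotProduct]
  simp only [mul_ite, mul_zero, Finset.sum_ite_mem, Finset.univ_inter]
  refine Finset.sum_congr rfl fun p hp => ?_
  rcases hB i p with h | h <;> norm_num [plusPoint, minusPoint, h, hf.map_zero p hp]

/-- Two noise terms enter each difference, so the true vector is feasible for (P1) with `ν = 2 * ε *
√n`. -/
theorem IsSparseAdditiveModel.norm_answerDiff_sub_le {n d : ℕ} {f : (Fin d → ℝ) → ℝ}
    {S : Finset (Fin d)} {μ : ℝ} {φ : Fin d → ℝ → ℝ} {L α D : ℝ}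
    (hf : IsSparseAdditiveModel f S μ φ L α D)
    {B : Matrix (Fin n) (Fin d) ℝ} (hB : ∀ i j, B i j = 1 ∨ B i j = -1) {c : ℝ}
    (hc : c ∈ Set.Icc (-1 : ℝ) 1) {ε : ℝ} (hε : 0 ≤ ε) {η : ℕ → ℝ} (hη : ∀ t, |η t| ≤ ε) (t : ℕ) :
    ‖WithLp.toLp 2 (answerDiff f η B (fun _ => c) t - B *ᵥ fun p => if p ∈ S then φ p c else 0)‖
      ≤ 2 * ε * √n := by
  refine le_of_sq_le_sq ?_ (by positivity)
  rw [mul_pow, Real.sq_sqrt (Nat.cast_nonneg n), l2_norm_toLp_sq]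
  calc _ ≤ ∑ _i : Fin n, (2 * ε) ^ 2 := by
        refine Finset.sum_le_sum fun i _ => ?_
        rw [← sq, sq_le_sq, Pi.sub_apply, ← hf.sub_eq_mulVec hB hc i, answerDiff]
        rw [abs_of_nonneg (by positivity : 0 ≤ 2 * ε)]
        have h1 := abs_le.1 (hη (t + 2 * i))
        have h2 := abs_le.1 (hη (t + 2 * i + 1))
        rw [abs_le]
        constructor <;> linarith
    _ = (2 * ε) ^ 2 * n := by
        rw [Finset.sum_const, Finset.card_univ, Fintype.card_fin, nsmul_eq_mul, mul_comm]

theorem mem_diagonalGrid {d m : ℕ} (hm : 0 < m) {x : Fin d → ℝ} (hx : x ∈ diagonalGrid d m) :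
    ∃ c ∈ Set.Icc (-1 : ℝ) 1, x = fun _ => c := by
  rw [diagonalGrid_eq, List.mem_map] at hx
  obtain ⟨j, hj, rfl⟩ := hx
  have hm' : (0 : ℝ) < m := by exact_mod_cast hm
  have hj' : (j : ℝ) ≤ 2 * m := by
    have := List.mem_range.1 hj
    exact_mod_cast (by omega : j ≤ 2 * m)
  refine ⟨_, ⟨?_, ?_⟩, rfl⟩
  · rw [le_div_iff₀ hm']
    linarith [(Nat.cast_nonneg j : (0 : ℝ) ≤ j)]
  · rw [div_le_one hm']
    linarith

theorem exists_mem_diagonalGrid_near {m : ℕ} (d : ℕ) (hm : 0 < m) {x : ℝ}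
    (hx : x ∈ Set.Icc (-1 : ℝ) 1) :
    ∃ c ∈ Set.Icc (-1 : ℝ) 1, (fun _ => c) ∈ diagonalGrid d m ∧ |x - c| ≤ 1 / m := by
  have hm' : (0 : ℝ) < m := by exact_mod_cast hm
  have h0 : 0 ≤ m * x + m := by nlinarith [hx.1]
  set j := ⌊m * x + m⌋₊ with hj
  have h1 : (j : ℝ) ≤ m * x + m := Nat.floor_le h0
  have h2 : m * x + m < j + 1 := Nat.lt_floor_add_one _
  have h3 : (j : ℝ) ≤ 2 * m := by nlinarith [hx.2]
  have h4 : j ≤ 2 * m := by exact_mod_cast h3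
  refine ⟨((j : ℝ) - m) / m, ⟨?_, ?_⟩, ?_, ?_⟩
  · rw [le_div_iff₀ hm']
    linarith [(Nat.cast_nonneg j : (0 : ℝ) ≤ j)]
  · rw [div_le_one hm']
    linarith
  · rw [diagonalGrid_eq, List.mem_map]
    exact ⟨j, List.mem_range.2 (by omega), rfl⟩
  · have e : x - ((j : ℝ) - m) / m = (m * x + m - j) / m := by
      field_simp
      ring
    rw [e, abs_of_nonneg (by apply div_nonneg <;> linarith)]
    gcongr
    linarith

/-- If the matrix is bounded from below on the cone belonging to `|S|`, the algorithm returns `S`. -/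
theorem IsSparseAdditiveModel.runAlgorithm_eq {n d m : ℕ} {f : (Fin d → ℝ) → ℝ}
    {S : Finset (Fin d)} {μ : ℝ} {φ : Fin d → ℝ → ℝ} {L α D ε : ℝ}
    (hf : IsSparseAdditiveModel f S μ φ L α D) (hL : 0 < L) (hα : 0 < α) (hD : 0 < D)
    (hε : 0 ≤ ε) (hεD : ε < D / 24) (hm : (3 * L / D) ^ (1 / α) ≤ (m : ℝ))
    (hn : S.Nonempty → 0 < n)
    {B : Matrix (Fin n) (Fin d) ℝ} (hB : ∀ i j, B i j = 1 ∨ B i j = -1)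
    (hcone : ∀ x : Fin d → ℝ, (∑ j, |x j|) ^ 2 ≤ 4 * S.card * (x ⬝ᵥ x) →
      (n : ℝ) / 4 * (x ⬝ᵥ x) ≤ (B *ᵥ x) ⬝ᵥ (B *ᵥ x))
    {η : ℕ → ℝ} (hη : ∀ t, |η t| ≤ ε)
    {sparseRec : (Fin n → ℝ) → Matrix (Fin n) (Fin d) ℝ → Fin d → ℝ}
    (hrec : IsP1Solver (2 * ε * √n) sparseRec) :
    (runAlgorithm f η sparseRec m (8 * ε) B).1 = S := by
  have hm' : (0 : ℝ) < m := (Real.rpow_pos_of_pos (by positivity) _).trans_le hm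
  have hm0 : 0 < m := by exact_mod_cast hm'
  have herr : ∀ c ∈ Set.Icc (-1 : ℝ) 1, ∀ t p,
      |sparseRec (answerDiff f η B (fun _ => c) t) B p - if p ∈ S then φ p c else 0| ≤ 8 * ε := by
    intro c hc t p
    have hfeas := hf.norm_answerDiff_sub_le hB hc hε hη t
    exact abs_sub_le_of_isP1Solution (w := fun p => if p ∈ S then φ p c else 0) hn hcone hε
      (fun j hj => if_neg hj) hfeas (hrec _ _ (exists_isP1Solution hfeas)) p
  obtain ⟨-, h2, h3⟩ := runAlgorithm_spec f η sparseRec m (8 * ε) B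
  refine Finset.Subset.antisymm (fun p hp => ?_) fun p hp => ?_
  · obtain ⟨x, hx, t, hpx⟩ := h3 p hp
    obtain ⟨c, hc, rfl⟩ := mem_diagonalGrid hm0 hx
    by_contra hpS
    have := herr c hc t p
    rw [if_neg hpS, sub_zero] at this
    exact absurd (Finset.mem_filter.1 hpx).2 this.not_gt
  · obtain ⟨x, hx, hDx⟩ := hf.identifiable p hp
    obtain ⟨c, hc, hgrid, hxc⟩ := exists_mem_diagonalGrid_near d hm0 hx
    obtain ⟨t, ht⟩ := h2 _ hgrid
    refine ht (Finset.mem_filter.2 ⟨Finset.mem_univ p, ?_⟩)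
    have h4 := herr c hc t p
    rw [if_pos hp] at h4
    -- Moving to the grid costs at most `D/3`, so `|φ p c| > 2 D / 3`. As `16 ε < 2 D / 3`,
    -- subtracting the recovery error `8 ε` still leaves more than the threshold `8 ε`.
    have h5 : L * |x - c| ^ α ≤ D / 3 := by
      have h6 : |x - c| ^ α ≤ (1 / m : ℝ) ^ α := Real.rpow_le_rpow (abs_nonneg _) hxc hα.le
      have h7 : 3 * L / D ≤ (m : ℝ) ^ α := by
        rw [one_div] at hm
        exact (Real.rpow_inv_le_iff_of_pos (by positivity) hm'.le hα).1 hm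
      rw [Real.div_rpow zero_le_one hm'.le, Real.one_rpow] at h6
      have h8 : (0 : ℝ) < (m : ℝ) ^ α := Real.rpow_pos_of_pos hm' α
      calc L * |x - c| ^ α ≤ L * (1 / (m : ℝ) ^ α) := by gcongr
        _ ≤ D / 3 := by
          rw [div_le_iff₀ hD] at h7
          rw [mul_one_div, div_le_iff₀ h8]
          linarith
    have h9 := hf.holder p hp x hx c hc
    have h10 := abs_sub_abs_le_abs_sub (φ p x) (φ p c)
    have h11 := abs_sub_abs_le_abs_sub (φ p c) (sparseRec (answerDiff f η B (fun _ => c) t) B p)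
    rw [abs_sub_comm] at h11
    linarith

/-! ### Choice of constants and conclusion -/

theorem mainTheorem5 :
    ∃ C₂ : ℝ, 0 < C₂ ∧ ∃ c₂ : ℝ, 0 < c₂ ∧ ∀ θ : ℝ, 0 < θ → θ < 1 → ∃ c₁ : ℝ, 0 < c₁ ∧
      ∀ (d n m : ℕ) (f : (Fin d → ℝ) → ℝ) (S : Finset (Fin d)) (μ : ℝ) (φ : Fin d → ℝ → ℝ)
        (L α D ε : ℝ) (Ω : Type*) (_ : MeasurableSpace Ω) (P : Measure Ω)
        (_ : IsProbabilityMeasure P) (B : Ω → Matrix (Fin n) (Fin d) ℝ),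
        0 < L → 0 < α → α ≤ 1 → 0 < D →
        IsSparseAdditiveModel f S μ φ L α D →
        (S.card : ℝ) ≤ θ * d →
        IsRademacherMatrix P B →
        0 ≤ ε → ε < D / (6 * C₂) →
        (3 * L / D) ^ (1 / α) ≤ (m : ℝ) →
        c₁ * S.card * Real.log (d / S.card) ≤ (n : ℝ) →
        1 - 2 * Real.exp (-c₂ * n) ≤
            P.real {ω | ∀ η : ℕ → ℝ, (∀ t, |η t| ≤ ε) →
              ∀ sparseRec, IsP1Solver (2 * ε * √n) sparseRec →
                (runAlgorithm f η sparseRec m (2 * C₂ * ε) (B ω)).1 = S} ∧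
          (∀ ω η sparseRec,
            (runAlgorithm f η sparseRec m (2 * C₂ * ε) (B ω)).2 = 2 * (2 * m + 1) * n) ∧
          1 < queryConst L D α ∧
          c₁ * (queryConst L D α * (S.card * Real.log (d / S.card))) ≤
            ((2 * (2 * m + 1) * n : ℕ) : ℝ) := by
  -- `C₂ = 4` makes the threshold `2 C₂ ε` equal to the recovery error `8 ε`; `1/48` is what the
  -- tail rate `1/24` leaves after the union bound.
  refine ⟨4, by norm_num, 1 / 48, by norm_num, fun θ hθ0 hθ1 => ?_⟩
  have hlogθ : 0 < Real.log (1 / θ) := Real.log_pos (by rw [lt_div_iff₀ hθ0]; linarith)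
  -- `432 = 9 * 48` comes from the union bound. Since `d / k ≥ 1 / θ`, the additive 2 beside `log (d
  -- / k)` is absorbed at the cost of the factor `1 + 2 / log (1 / θ)`.
  refine ⟨432 * (1 + 2 / Real.log (1 / θ)), by positivity, ?_⟩
  intro d n m f S μ φ L α D ε Ω _ P _ B hL hα _ hD hf hS hB hε hεD hm hn
  rw [show (2 : ℝ) * 4 = 8 by norm_num]
  rw [show (6 : ℝ) * 4 = 24 by norm_num] at hεD
  set c₁ := 432 * (1 + 2 / Real.log (1 / θ)) with hc₁
  have hc₁0 : 0 < c₁ := by positivity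
  have hθlog : S.Nonempty → Real.log (1 / θ) ≤ Real.log (d / S.card) := by
    intro hne
    have hk : (0 : ℝ) < S.card := by exact_mod_cast hne.card_pos
    refine Real.log_le_log (by positivity) ?_
    rw [div_le_div_iff₀ hθ0 hk]
    linarith
  have hklog : 0 ≤ S.card * Real.log (d / S.card) := by
    rcases S.eq_empty_or_nonempty with h | h
    · simp [h]
    · exact mul_nonneg (Nat.cast_nonneg _) (hlogθ.le.trans (hθlog h))
  have hr : 0 < (3 * L / D) ^ (1 / α) := Real.rpow_pos_of_pos (by positivity) _
  refine ⟨?_, fun ω η sparseRec => (runAlgorithm_spec f η sparseRec m (8 * ε) (B ω)).1, ?_, ?_⟩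
  · rcases S.eq_empty_or_nonempty with hne | hne
    · have huniv : {ω | ∀ η : ℕ → ℝ, (∀ t, |η t| ≤ ε) →
          ∀ sparseRec, IsP1Solver (2 * ε * √n) sparseRec →
            (runAlgorithm f η sparseRec m (8 * ε) (B ω)).1 = S} = Set.univ := by
        refine Set.eq_univ_of_forall fun ω η hη sparseRec hrec =>
          hf.runAlgorithm_eq hL hα hD hε hεD hm (fun h => absurd hne h.ne_empty)
            (hB.mem_signs ω) (fun x hx => ?_) hη hrec
        have hx0 : ∑ j, |x j| = 0 := by
          simp only [hne, Finset.card_empty, Nat.cast_zero, mul_zero, zero_mul] at hx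
          exact pow_eq_zero_iff two_ne_zero |>.1 (le_antisymm hx (sq_nonneg _))
        have : x = 0 := funext fun j => abs_eq_zero.1
          ((Finset.sum_eq_zero_iff_of_nonneg fun j _ => abs_nonneg _).1 hx0 j (Finset.mem_univ j))
        simp [this]
      rw [huniv, probReal_univ]
      linarith [Real.exp_pos (-(1 / 48) * (n : ℝ))]
    · have hk : (0 : ℝ) < S.card := by exact_mod_cast hne.card_pos
      have hl := hθlog hne
      have hn' : 432 * S.card * (Real.log (d / S.card) + 2) ≤ (n : ℝ) := by
        refine le_trans ?_ hn
        have h2 : 2 ≤ 2 / Real.log (1 / θ) * Real.log (d / S.card) := by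
          rw [div_mul_eq_mul_div, le_div_iff₀ hlogθ]
          linarith
        calc 432 * S.card * (Real.log (d / S.card) + 2)
            ≤ 432 * S.card *
              (Real.log (d / S.card) + 2 / Real.log (1 / θ) * Real.log (d / S.card)) := by gcongr
          _ = c₁ * S.card * Real.log (d / S.card) := by rw [hc₁]; ring
      have hn0 : 0 < n := by
        have : (0 : ℝ) < n := lt_of_lt_of_le
          (mul_pos (by positivity) (by linarith)) hn'
        exact_mod_cast this
      have hkd : S.card ≤ d := by simpa using S.card_le_univ
      have hprob := hB.signedBasis_lower_bound hne.card_pos hkd hn'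
      have he : Real.exp (-(1 / 48) * (n : ℝ)) = Real.exp (-(n / 48)) := by
        congr 1
        ring
      rw [he]
      refine le_trans (by linarith [Real.exp_pos (-((n : ℝ) / 48))]) (hprob.trans
        (measureReal_mono fun ω hω η hη sparseRec hrec => ?_))
      exact hf.runAlgorithm_eq hL hα hD hε hεD hm (fun _ => hn0) (hB.mem_signs ω)
        (cone_lower_bound hne.card_pos (B ω) (hB.mem_signs ω) hω) hη hrec
  · unfold queryConst
    linarith
  · have hq : queryConst L D α ≤ 2 * (2 * m + 1) := by
      unfold queryConst
      linarith
    push_cast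
    calc c₁ * (queryConst L D α * (S.card * Real.log (d / S.card)))
        = queryConst L D α * (c₁ * S.card * Real.log (d / S.card)) := by ring
      _ ≤ 2 * (2 * m + 1) * n := by
        refine mul_le_mul hq hn ?_ (by positivity)
        rw [mul_assoc]
        positivity
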